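/- Let $X$ be a discrete torsion Abelian group containing no elements of order $2$ such that, for every prime $p$, the $p$-component of $X$ (the subgroup of all elements whose order is a power of $p$) is cyclic. Let $Y$ be the character group of $X$, let $(x,y)$ be the value of the character $y\in Y$ at $x\in X$, let $\alpha$ be an automorphism of $X$, and let $I$ be the identity automorphism of $X$. For a probability distribution $\mu$ on $X$ let $\hat\mu(y)=\int_X (x,y)\,d\mu(x)$, $y\in Y$, be its characteristic function. Let $\xi_1$ and $\xi_2$ be independent random variables with values in $X$ and distributions $\mu_1$ and $\mu_2$. Assume that the conditional distribution of $L_2=\xi_1+\alpha\xi_2$ given $L_1=\xi_1+\xi_2$ is symmetric, that is, for every $B\subseteq X$ the conditional probabilities of $L_2\in B$ and of $-L_2\in B$ given $L_1$ coincide almost surely, and that $$\{y\in Y:\ |\hat\mu_1(y)|=|\hat\mu_2(y)|=1\}=\{0\}.$$ Then there is a distribution $\mu$ on $X$ with $\mu_1=\mu_2=\mu$; the group $X$ is the minimal subgroup containing the support of $\mu$; the subgroup $(I+\alpha)(X)$ is finite; the Haar distribution (Haar probability measure) $m_{(I+\alpha)(X)}$ is a factor of $\mu$, that is, $\mu=m_{(I+\alpha)(X)}*\rho$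 for some probability distribution $\rho$ on $X$; and $I-\alpha$ is an automorphism of $X$. -/

import Mathlib

open MeasureTheory ProbabilityTheory

noncomputable section

namespace Heyde

/-- The characteristic function of a distribution `μ` on a discrete Abelian group `X`, i.e. the
Fourier transform `y ↦ ∫ (x, y) dμ(x)` on the character group. As `X` is discrete, every
homomorphism from `X` to the circle is a (continuous) character, so the character group is
`AddChar X Circle`. -/
def charFunction {X : Type*} [AddCommGroup X] [MeasurableSpace X]
    (μ : Measure X) (y : AddChar X Circle) : ℂ :=
  ∫ x, (y x : ℂ) ∂μ

/-- The conditional distribution of `L₂` given `L₁` is symmetric: for every measurable set `B`,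
the conditional probabilities of `L₂ ∈ B` and of `-L₂ ∈ B` given (the σ-algebra generated by) `L₁`
coincide almost surely. -/
def CondSymmetric {Ω X S : Type*} [MeasurableSpace Ω] [AddCommGroup X] [MeasurableSpace X]
    [MeasurableSpace S] (P : Measure Ω) (L₂ : Ω → X) (L₁ : Ω → S) : Prop :=
  ∀ B : Set X, MeasurableSet B →
    P⟦{ω | L₂ ω ∈ B} | MeasurableSpace.comap L₁ inferInstance⟧
      =ᵐ[P] P⟦{ω | -L₂ ω ∈ B} | MeasurableSpace.comap L₁ inferInstance⟧

/-- The Haar distribution `m_K` of a compact subgroup `K` of `X`: the Haar probability measure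
of `K`, regarded as a distribution on `X`. -/
def haarDistribution {X : Type*} [AddCommGroup X] [TopologicalSpace X] [IsTopologicalAddGroup X]
    [MeasurableSpace X] [BorelSpace X] (K : AddSubgroup X) [CompactSpace K] : Measure X :=
  (Measure.addHaarMeasure (⊤ : TopologicalSpace.PositiveCompacts K)).map (fun k : K => (k : X))

/-- `ν` is a factor of `μ`: there is a distribution `ρ` with `μ = ν * ρ` (convolution). -/
def IsFactor {X : Type*} [AddCommGroup X] [MeasurableSpace X] (ν μ : Measure X) : Prop :=
  ∃ ρ : Measure X, IsProbabilityMeasure ρ ∧ μ = Measure.conv ν ρ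

/-- The subgroup `(I + α)(X)`. -/
def rangeIdAdd {X : Type*} [AddCommGroup X] (α : X ≃+ X) : AddSubgroup X :=
  (AddMonoidHom.id X + α.toAddMonoidHom).range

end Heyde

end

/-! Conditional symmetry says that (L₁, L₂) and (L₁, -L₂) have the same law; tested on characters
this is Heyde's equation `charFunction_mul_charFunction_eq`. Write f, g for the transforms of μ₁, μ₂
and let endomorphisms of X act on characters by composition. Taking u = v gives g((I-α)v) = f(2v)
g((I+α)v); taking u = αv gives |f((I-α)v)| = |f((I+α)v)| |g(2αv)|. If v is trivial on (I-α)(X), the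
first relation forces |f(2v)| = |g(2v)| = 1, so 2v = 0 and v = 0. Hence I-α is onto, and it is
injective because the p-components are finite.

Inverting I-α and inserting the second relation into the first writes |g(w)| as |g(γw)| times two
factors at most 1, with γ an automorphism. X has finitely many elements of each order, so γ has
finite orbits and |g(γw)| = |g(w)| (`norm_charFunction_comp_eq`). Where g(w) ≠ 0 the two factors are
therefore 1. Automorphisms preserve every cyclic subgroup, so this yields |f| = |g| = 1 at (I+α)w,
whence (I+α)w = 0 (`apply_eq_one_of_charFunction_ne_zero`).

Thus f and g vanish off the annihilator of (I+α)(X), and on it the first relation reads g = f.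
Uniqueness gives μ₁ = μ₂; the vanishing gives finiteness and the Haar factor. -/

namespace Heyde

/-! ### Torsion groups with cyclic p-components -/

section Torsion

variable {X : Type*} [AddCommGroup X]

theorem finite_primaryComponent (p : ℕ) (hp : p.Prime)
    (hc : IsAddCyclic (AddCommGroup.primaryComponent X p)) :
    Finite (AddCommGroup.primaryComponent X p) := by
  obtain ⟨⟨g, k, hk⟩, hg⟩ := hc.exists_generator
  have hg' : IsOfFinAddOrder (⟨g, k, hk⟩ : AddCommGroup.primaryComponent X p) :=
    isOfFinAddOrder_iff_nsmul_eq_zero.2 ⟨p ^ k, pow_pos hp.pos k, Subtype.ext hk⟩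
  have : Finite (AddSubgroup.zmultiples (⟨g, k, hk⟩ : AddCommGroup.primaryComponent X p)) :=
    hg'.finite_zmultiples
  exact Finite.of_surjective _ (fun x => ⟨⟨x, hg x⟩, rfl⟩ :
    Function.Surjective (Subtype.val : AddSubgroup.zmultiples
      (⟨g, k, hk⟩ : AddCommGroup.primaryComponent X p) → _))

/-- With n the order of `x`, a cyclic group has at most n solutions of n • z = 0, and the multiples
of `x` already supply n of them. -/
theorem mem_zmultiples_of_isAddCyclic {C : Type*} [AddCommGroup C] [Finite C] [IsAddCyclic C]
    {x y : C} (h : addOrderOf x • y = 0) : y ∈ AddSubgroup.zmultiples x := by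
  classical
  have := Fintype.ofFinite C
  have hpos : 0 < addOrderOf x := addOrderOf_pos x
  have hsub : (AddSubgroup.zmultiples x : Set C).toFinset ⊆
      Finset.univ.filter (fun z : C => addOrderOf x • z = 0) := by
    intro z hz
    obtain ⟨k, rfl⟩ := AddSubgroup.mem_zmultiples_iff.1 (by simpa using hz)
    simp [smul_comm _ k x, addOrderOf_nsmul_eq_zero]
  have hle := IsAddCyclic.card_nsmul_eq_zero_le (α := C) hpos
  have hcard : (AddSubgroup.zmultiples x : Set C).toFinset.card = addOrderOf x := by
    rw [Set.toFinset_card, ← Nat.card_zmultiples x, Nat.card_eq_fintype_card]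
    rfl
  have heq := Finset.eq_of_subset_of_card_le hsub (hle.trans hcard.ge)
  have : y ∈ (AddSubgroup.zmultiples x : Set C).toFinset := by
    rw [heq]; simpa using h
  simpa using this

variable (hcyc : ∀ p : ℕ, p.Prime → IsAddCyclic (AddCommGroup.primaryComponent X p))
include hcyc

theorem mem_zmultiples_of_nsmul_eq_zero (n : ℕ) (hn : n ≠ 0) :
    ∀ x y : X, addOrderOf x = n → n • y = 0 → y ∈ AddSubgroup.zmultiples x := by
  induction n using Nat.recOnPosPrimePosCoprime with
  | zero => exact absurd rfl hn
  | one =>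
    intro x y _ hy
    rw [one_nsmul] at hy
    simp [hy]
  | prime_pow p k hp hk =>
    intro x y hx hy
    have := hcyc p hp
    have := finite_primaryComponent p hp this
    let x' : AddCommGroup.primaryComponent X p := ⟨x, k, hx ▸ addOrderOf_nsmul_eq_zero x⟩
    let y' : AddCommGroup.primaryComponent X p := ⟨y, k, hy⟩
    have hx' : addOrderOf x' = p ^ k := by rw [← hx]; exact (AddSubgroup.addOrderOf_coe x').symm
    have h : y' ∈ AddSubgroup.zmultiples x' :=
      mem_zmultiples_of_isAddCyclic (by rw [hx']; exact Subtype.ext hy)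
    obtain ⟨m, hm⟩ := AddSubgroup.mem_zmultiples_iff.1 h
    exact AddSubgroup.mem_zmultiples_iff.2 ⟨m, congrArg Subtype.val hm⟩
  | coprime a b ha hb hab iha ihb =>
    intro x y hx hy
    have h1 : b • y ∈ AddSubgroup.zmultiples (b • x) := by
      refine iha (by lia) _ _ ?_ (by rw [← mul_nsmul', hy])
      rw [addOrderOf_nsmul_of_dvd (by lia) (by rw [hx]; exact Dvd.intro_left a rfl), hx,
        Nat.mul_div_cancel _ (by lia)]
    have h2 : a • y ∈ AddSubgroup.zmultiples (a • x) := by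
      refine ihb (by lia) _ _ ?_ (by rw [← mul_nsmul, hy])
      rw [addOrderOf_nsmul_of_dvd (by lia) (by rw [hx]; exact Dvd.intro b rfl), hx,
        Nat.mul_div_cancel_left _ (by lia)]
    have h1' : b • y ∈ AddSubgroup.zmultiples x :=
      AddSubgroup.zmultiples_le_of_mem (AddSubgroup.nsmul_mem_zmultiples x b) h1
    have h2' : a • y ∈ AddSubgroup.zmultiples x :=
      AddSubgroup.zmultiples_le_of_mem (AddSubgroup.nsmul_mem_zmultiples x a) h2
    have key : y = (Nat.gcdA a b) • (a • y) + (Nat.gcdB a b) • (b • y) := by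
      rw [← natCast_zsmul y a, ← natCast_zsmul y b, smul_smul, smul_smul, ← add_smul,
        mul_comm, mul_comm (Nat.gcdB a b), ← Nat.gcd_eq_gcd_ab, hab.gcd_eq_one]
      simp
    rw [key]
    exact add_mem (zsmul_mem h2' _) (zsmul_mem h1' _)

variable (htors : IsAddTorsion X)
include htors

theorem mem_zmultiples_of_addOrderOf_eq {x y : X} (h : addOrderOf y = addOrderOf x) :
    y ∈ AddSubgroup.zmultiples x :=
  mem_zmultiples_of_nsmul_eq_zero hcyc (addOrderOf x) (htors x).addOrderOf_pos.ne' x y rfl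
    (h ▸ addOrderOf_nsmul_eq_zero y)

theorem finite_setOf_addOrderOf_eq (n : ℕ) : {x : X | addOrderOf x = n}.Finite := by
  rcases Set.eq_empty_or_nonempty {x : X | addOrderOf x = n} with h | ⟨x, hx⟩
  · rw [h]; exact Set.finite_empty
  · have : Finite (AddSubgroup.zmultiples x) := (htors x).finite_zmultiples
    exact (Set.toFinite (AddSubgroup.zmultiples x : Set X)).subset fun y hy =>
      mem_zmultiples_of_addOrderOf_eq hcyc htors (hy.trans hx.symm)

theorem countable_of_isAddCyclic_primaryComponent : Countable X := by
  have : (⋃ n : ℕ, {x : X | addOrderOf x = n}) = Set.univ := by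
    ext x; simp
  rw [← Set.countable_univ_iff, ← this]
  exact Set.countable_iUnion fun n => (finite_setOf_addOrderOf_eq hcyc htors n).countable

theorem exists_iterate_addEquiv_apply_eq (γ : X ≃+ X) (x : X) :
    ∃ k : ℕ, 0 < k ∧ γ^[k] x = x := by
  have hord : ∀ k : ℕ, addOrderOf (γ^[k] x) = addOrderOf x := by
    intro k
    induction k with
    | zero => rfl
    | succ k ih => rw [Function.iterate_succ_apply', AddEquiv.addOrderOf_eq, ih]
  have : Finite {z : X | addOrderOf z = addOrderOf x} :=
    (finite_setOf_addOrderOf_eq hcyc htors (addOrderOf x)).to_subtype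
  obtain ⟨i, j, hij, h⟩ : ∃ i j : ℕ, i < j ∧ γ^[i] x = γ^[j] x := by
    obtain ⟨i, j, hij, h⟩ := Finite.exists_ne_map_eq_of_infinite
      (fun k : ℕ => (⟨γ^[k] x, hord k⟩ : {z : X | addOrderOf z = addOrderOf x}))
    have h' : γ^[i] x = γ^[j] x := congrArg Subtype.val h
    rcases lt_or_gt_of_ne hij with hl | hl
    · exact ⟨i, j, hl, h'⟩
    · exact ⟨j, i, hl, h'.symm⟩
  refine ⟨j - i, by lia, γ.injective.iterate i ?_⟩
  rw [h, ← Function.iterate_add_apply, Nat.add_sub_cancel' hij.le]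

/-- The map restricts to a surjection of each p-component, which is finite, so the restriction is
injective; a nonzero kernel would contain an element of prime order. -/
theorem bijective_of_surjective (φ : X →+ X) (hφ : Function.Surjective φ) :
    Function.Bijective φ := by
  refine ⟨(injective_iff_map_eq_zero φ).2 fun x hx => ?_, hφ⟩
  by_contra hx0
  have hord : addOrderOf x ≠ 1 := by simpa using hx0
  obtain ⟨p, hp, m, hm⟩ := Nat.exists_prime_and_dvd hord
  have hm0 : m ≠ 0 := by
    rintro rfl
    exact (htors x).addOrderOf_pos.ne' (by simpa using hm)
  let C := AddCommGroup.primaryComponent X p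
  have hcycC := hcyc p hp
  have : Finite C := finite_primaryComponent p hp hcycC
  let φC : C →+ C := (φ.comp C.subtype).codRestrict C fun c => by
    obtain ⟨c, k, hk⟩ := c
    exact ⟨k, by simp [← map_nsmul, hk]⟩
  obtain ⟨c, hc⟩ := hcycC.exists_generator
  obtain ⟨c, k, hk⟩ := c
  obtain ⟨z, hz⟩ := hφ c
  obtain ⟨r, s, hs, hrs⟩ := Nat.exists_eq_pow_mul_and_not_dvd
    (htors z).addOrderOf_pos.ne' p hp.ne_one
  -- Multiplying by `s` kills the prime-to-p part of `z`; it is undone on `c`, since `s` is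
  -- invertible modulo `p ^ k`, which kills `c`.
  have hsz : s • z ∈ C := ⟨r, by rw [← mul_nsmul', ← hrs, addOrderOf_nsmul_eq_zero]⟩
  have hsurj : Function.Surjective φC := by
    intro d
    have hcop : Nat.Coprime s (p ^ k) := (Nat.Coprime.pow_left k ((hp.coprime_iff_not_dvd).2 hs)).symm
    have hc' : c = (Nat.gcdA s (p ^ k)) • (s • c) := by
      have h1 : (1 : ℤ) • c = ((s : ℤ) * Nat.gcdA s (p ^ k) +
          ((p ^ k : ℕ) : ℤ) * Nat.gcdB s (p ^ k)) • c := by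
        rw [← Nat.gcd_eq_gcd_ab, hcop.gcd_eq_one]; simp
      rw [one_smul, add_smul, mul_comm, mul_comm _ (Nat.gcdB s (p ^ k)), mul_smul, mul_smul,
        natCast_zsmul, natCast_zsmul, show p ^ k • c = 0 from hk, smul_zero, add_zero] at h1
      exact h1
    obtain ⟨t, ht⟩ := AddSubgroup.mem_zmultiples_iff.1 (hc d)
    refine ⟨t • (Nat.gcdA s (p ^ k)) • ⟨s • z, hsz⟩, ?_⟩
    rw [map_zsmul, map_zsmul, ← ht]
    congr 1
    refine Subtype.ext ?_
    change Nat.gcdA s (p ^ k) • φ (s • z) = c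
    rw [map_nsmul, hz, ← hc']
  have hinj : Function.Injective φC := Finite.injective_iff_surjective.2 hsurj
  have hmx : p • (m • x) = 0 := by rw [← mul_nsmul', ← hm, addOrderOf_nsmul_eq_zero]
  let w : C := ⟨m • x, 1, by simpa using hmx⟩
  have hw : w = 0 := hinj (by
    rw [map_zero]
    exact Subtype.ext (by change φ (m • x) = 0; rw [map_nsmul, hx, smul_zero]))
  have hmx0 : m • x = 0 := congrArg Subtype.val hw
  have := addOrderOf_dvd_of_nsmul_eq_zero hmx0
  rw [hm] at this
  have h2 := Nat.le_of_dvd (Nat.pos_of_ne_zero hm0) this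
  nlinarith [hp.two_le, Nat.pos_of_ne_zero hm0]

omit hcyc in
theorem bijective_two_nsmul (h2 : ∀ x : X, addOrderOf x ≠ 2) :
    Function.Bijective (fun x : X => x + x) := by
  constructor
  · intro x y hxy
    have h : 2 • (x - y) = 0 := by
      rw [smul_sub, two_nsmul, two_nsmul]; exact sub_eq_zero.2 hxy
    by_contra hne
    exact h2 (x - y) (addOrderOf_eq_prime h (sub_ne_zero.2 hne))
  · intro x
    have hodd : Odd (addOrderOf x) := by
      by_contra he
      obtain ⟨k, hk⟩ := Nat.not_odd_iff_even.1 he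
      have hpos := (htors x).addOrderOf_pos
      refine h2 (k • x) (addOrderOf_eq_prime ?_ fun h0 => ?_)
      · rw [← mul_nsmul', two_mul, ← hk, addOrderOf_nsmul_eq_zero]
      · have := Nat.le_of_dvd (by lia) (addOrderOf_dvd_of_nsmul_eq_zero h0)
        lia
    obtain ⟨k, hk⟩ := hodd
    refine ⟨(k + 1) • x, ?_⟩
    have := addOrderOf_nsmul_eq_zero x
    rw [hk, add_smul, mul_nsmul, one_nsmul, two_nsmul] at this
    rw [add_smul, one_smul]
    calc k • x + x + (k • x + x) = (k • (x + x) + x) + x := by rw [smul_add]; abel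
      _ = x := by rw [smul_add, ← smul_add, this, zero_add]

end Torsion

/-! ### Separation by characters -/

section Characters

variable {X : Type*} [AddCommGroup X]

/-- Characters into ℚ/ℤ separate points, and ℚ/ℤ embeds in ℝ/ℤ, hence in the circle. -/
theorem exists_addChar_circle_apply_ne_one {x : X} (hx : x ≠ 0) :
    ∃ y : AddChar X Circle, y x ≠ 1 := by
  obtain ⟨c, hc⟩ := CharacterModule.exists_character_apply_ne_zero_of_ne_zero hx
  let φ : AddCircle (1 : ℚ) →+ AddCircle (1 : ℝ) :=
    QuotientAddGroup.map _ _ (Rat.castHom ℝ).toAddMonoidHom (by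
      rw [AddSubgroup.zmultiples_le]
      exact AddSubgroup.mem_comap.2 (by simp))
  have hφ : Function.Injective φ := by
    refine (injective_iff_map_eq_zero φ).2 fun q => ?_
    induction q using QuotientAddGroup.induction_on with
    | H q =>
      intro h
      have h' : ((q : ℝ) : AddCircle (1 : ℝ)) = 0 := h
      rw [AddCircle.coe_eq_zero_iff] at h'
      obtain ⟨n, hn⟩ := h'
      refine (AddCircle.coe_eq_zero_iff (1 : ℚ)).2 ⟨n, ?_⟩
      have : ((n : ℚ) : ℝ) = (q : ℝ) := by simpa using hn
      simpa using (Rat.cast_injective this)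
  refine ⟨AddCircle.toCircle_addChar.compAddMonoidHom (φ.comp (c : X →+ AddCircle (1 : ℚ))), ?_⟩
  intro h
  have h1 : AddCircle.toCircle (φ (c x)) = AddCircle.toCircle (0 : AddCircle (1 : ℝ)) := by
    rw [AddCircle.toCircle_zero]; exact h
  exact hc (hφ ((AddCircle.injective_toCircle one_ne_zero h1).trans (map_zero φ).symm))

theorem le_of_forall_addChar {H K : AddSubgroup X}
    (h : ∀ y : AddChar X Circle, (∀ x ∈ H, y x = 1) → ∀ x ∈ K, y x = 1) : K ≤ H := by
  intro x hx
  by_contra hxH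
  have hx0 : (QuotientAddGroup.mk' H x) ≠ 0 := fun h0 =>
    hxH ((QuotientAddGroup.eq_zero_iff x).1 h0)
  obtain ⟨y, hy⟩ := exists_addChar_circle_apply_ne_one hx0
  refine hy (h (y.compAddMonoidHom (QuotientAddGroup.mk' H)) (fun z hz => ?_) x hx)
  rw [AddChar.compAddMonoidHom_apply, show QuotientAddGroup.mk' H z = 0 from
    (QuotientAddGroup.eq_zero_iff z).2 hz, AddChar.map_zero_eq_one]

end Characters
-- Basic properties of characteristic functions
section CharFunction

variable {X : Type*} [AddCommGroup X] [MeasurableSpace X] [DiscreteMeasurableSpace X]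

theorem integrable_addChar (μ : Measure X) [IsFiniteMeasure μ] [Countable X]
    (y : AddChar X Circle) :
    Integrable (fun x => (y x : ℂ)) μ :=
  Integrable.of_bound (C := 1) (Measurable.of_discrete.aestronglyMeasurable)
    (Filter.Eventually.of_forall fun _ => (Circle.norm_coe _).le)

omit [DiscreteMeasurableSpace X] in
theorem norm_charFunction_le_one (μ : Measure X) [IsProbabilityMeasure μ]
    (y : AddChar X Circle) : ‖charFunction μ y‖ ≤ 1 := by
  have := norm_integral_le_of_norm_le_const (μ := μ) (f := fun x => (y x : ℂ)) (C := 1)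
    (Filter.Eventually.of_forall fun _ => (Circle.norm_coe _).le)
  simpa [charFunction] using this

omit [DiscreteMeasurableSpace X] in
theorem charFunction_zero (μ : Measure X) [IsProbabilityMeasure μ] :
    charFunction μ 0 = 1 := by
  simp [charFunction]

omit [DiscreteMeasurableSpace X] in
theorem charFunction_neg (μ : Measure X) (y : AddChar X Circle) :
    charFunction μ (-y) = starRingEnd ℂ (charFunction μ y) := by
  rw [charFunction, charFunction, ← integral_conj]
  congr 1
  ext x
  rw [AddChar.neg_apply, AddChar.map_neg_eq_inv, Circle.coe_inv_eq_conj]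

variable [Countable X]

omit [DiscreteMeasurableSpace X] in
theorem charFunction_eq_one_of_forall (μ : Measure X) [IsProbabilityMeasure μ]
    {y : AddChar X Circle} (h : ∀ x, μ {x} ≠ 0 → y x = 1) : charFunction μ y = 1 := by
  have : (fun x => (y x : ℂ)) =ᵐ[μ] fun _ => 1 := by
    refine (ae_iff_of_countable).2 fun x hx => ?_
    exact (congrArg Subtype.val (h x hx)).trans Circle.coe_one
  rw [charFunction, integral_congr_ae this]
  simp

omit [DiscreteMeasurableSpace X] in
-- Equality in the bound for an average of unimodular numbers forces them to agree on all atoms.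
theorem norm_charFunction_eq_one_iff (μ : Measure X) [IsProbabilityMeasure μ]
    (y : AddChar X Circle) :
    ‖charFunction μ y‖ = 1 ↔ ∀ x x', μ {x} ≠ 0 → μ {x'} ≠ 0 → y (x - x') = 1 := by
  constructor
  · intro h x x' hx hx'
    rcases ae_eq_const_or_norm_integral_lt_of_norm_le_const (μ := μ)
      (f := fun x => (y x : ℂ)) (C := 1) (Filter.Eventually.of_forall fun _ => (Circle.norm_coe _).le)
      with h1 | h1
    · have h2 := ae_iff_of_countable.1 h1
      have h3 : (y x : ℂ) = y x' := (h2 x hx).trans (h2 x' hx').symm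
      rw [AddChar.map_sub_eq_div, Circle.coe_injective h3, div_self']
    · rw [probReal_univ, mul_one] at h1
      exact absurd h h1.ne
  · intro h
    obtain ⟨x₀, hx₀⟩ : ∃ x, μ {x} ≠ 0 := by
      by_contra! hne
      have : μ = 0 := Measure.ext_of_singleton fun a => by simp [hne a]
      exact IsProbabilityMeasure.ne_zero μ this
    have : (fun x => (y x : ℂ)) =ᵐ[μ] fun _ => (y x₀ : ℂ) := by
      refine (ae_iff_of_countable).2 fun x hx => ?_
      have := h x x₀ hx hx₀
      rw [AddChar.map_sub_eq_div, div_eq_one] at this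
      exact congrArg Subtype.val this
    rw [charFunction, integral_congr_ae this]
    simp [Circle.norm_coe]

theorem charFunction_conv (μ ν : Measure X) [IsProbabilityMeasure μ] [IsProbabilityMeasure ν]
    (y : AddChar X Circle) :
    charFunction (μ.conv ν) y = charFunction μ y * charFunction ν y := by
  rw [charFunction, integral_conv (integrable_addChar _ y)]
  simp_rw [AddChar.map_add_eq_mul, Circle.coe_mul, integral_const_mul, integral_mul_const]
  rfl

end CharFunction

/-! ### Uniqueness of the Fourier transform -/

section Uniqueness

variable {X : Type*} [AddCommGroup X] [TopologicalSpace X] [DiscreteTopology X]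
  [MeasurableSpace X] [BorelSpace X] [Countable X]

open BoundedContinuousFunction in
/-- The characters of a discrete group, as a monoid homomorphism into the bounded functions. -/
noncomputable def charBCF (X : Type*) [AddCommGroup X] [TopologicalSpace X] [DiscreteTopology X] :
    AddChar X Circle →* (X →ᵇ ℂ) where
  toFun y := BoundedContinuousFunction.ofNormedAddCommGroup (fun x => (y x : ℂ))
    continuous_of_discreteTopology 1 (fun _ => (Circle.norm_coe _).le)
  map_one' := by ext x; simp
  map_mul' y z := by ext x; simp

open BoundedContinuousFunction in
-- Characters are closed under products and conjugation, so their span is a star subalgebra; it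
-- separates points, hence determines a finite measure on a Polish space.
theorem eq_of_charFunction_eq {μ ν : Measure X} [IsProbabilityMeasure μ] [IsProbabilityMeasure ν]
    (h : ∀ y, charFunction μ y = charFunction ν y) : μ = ν := by
  let S : Submonoid (X →ᵇ ℂ) := MonoidHom.mrange (charBCF X)
  have hstar : ∀ a ∈ Algebra.adjoin ℂ (S : Set (X →ᵇ ℂ)),
      star a ∈ Algebra.adjoin ℂ (S : Set (X →ᵇ ℂ)) := by
    intro a ha
    induction ha using Algebra.adjoin_induction with
    | mem a ha =>
      obtain ⟨y, rfl⟩ := ha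
      refine Algebra.subset_adjoin ⟨y⁻¹, ?_⟩
      ext x
      simp [charBCF, AddChar.inv_apply, AddChar.map_neg_eq_inv, ← Circle.coe_inv_eq_conj]
    | algebraMap r =>
      rw [← algebraMap_star_comm]
      exact Subalgebra.algebraMap_mem _ _
    | add a b _ _ ha hb => rw [star_add]; exact add_mem ha hb
    | mul a b _ _ ha hb => rw [star_mul]; exact mul_mem hb ha
  let A : StarSubalgebra ℂ (X →ᵇ ℂ) :=
    { Algebra.adjoin ℂ (S : Set (X →ᵇ ℂ)) with star_mem' := fun {a} ha => hstar a ha }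
  refine ext_of_forall_mem_subalgebra_integral_eq_of_polish (𝕜 := ℂ) (A := A) ?_ ?_
  · intro x x' hne
    obtain ⟨y, hy⟩ := exists_addChar_circle_apply_ne_one (sub_ne_zero.2 hne)
    refine ⟨charBCF X y, ⟨_, ⟨charBCF X y, Algebra.subset_adjoin ⟨y, rfl⟩, rfl⟩, rfl⟩, ?_⟩
    intro he
    refine hy ?_
    have : y x = y x' := Circle.coe_injective he
    rw [AddChar.map_sub_eq_div, this, div_self']
  · intro g hg
    have hg' : g ∈ Submodule.span ℂ (S : Set (X →ᵇ ℂ)) := by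
      have : g ∈ Subalgebra.toSubmodule (Algebra.adjoin ℂ (S : Set (X →ᵇ ℂ))) := hg
      rwa [Algebra.adjoin_eq_span, S.closure_eq] at this
    clear hg
    induction hg' using Submodule.span_induction with
    | mem a ha =>
      obtain ⟨y, rfl⟩ := ha
      exact h y
    | zero => simp
    | add a b _ _ ha hb =>
      simp only [coe_add, Pi.add_apply]
      rw [integral_add (a.integrable _) (b.integrable _),
        integral_add (a.integrable _) (b.integrable _), ha, hb]
    | smul c a _ ha =>
      simp only [coe_smul]
      rw [integral_smul, integral_smul, ha]

end Uniqueness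

/-! ### Haar factors, finiteness and minimal support -/

section Haar

variable {X : Type*} [AddCommGroup X] [TopologicalSpace X] [DiscreteTopology X]
  [MeasurableSpace X] [BorelSpace X] [Countable X]

omit [Countable X] in
theorem isProbabilityMeasure_haarDistribution (K : AddSubgroup X) [CompactSpace K] :
    IsProbabilityMeasure (haarDistribution K) := by
  have : IsProbabilityMeasure
      (Measure.addHaarMeasure (⊤ : TopologicalSpace.PositiveCompacts K)) :=
    ⟨by simpa using Measure.addHaarMeasure_self (K₀ := (⊤ : TopologicalSpace.PositiveCompacts K))⟩
  exact Measure.isProbabilityMeasure_map measurable_subtype_coe.aemeasurable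

theorem charFunction_haarDistribution_eq_one (K : AddSubgroup X) [CompactSpace K]
    {y : AddChar X Circle} (hy : ∀ x ∈ K, y x = 1) :
    charFunction (haarDistribution K) y = 1 := by
  have := isProbabilityMeasure_haarDistribution K
  refine charFunction_eq_one_of_forall _ fun x hx => hy x ?_
  by_contra hxK
  refine hx ?_
  rw [haarDistribution, Measure.map_apply measurable_subtype_coe (measurableSet_singleton x)]
  convert! measure_empty (μ := Measure.addHaarMeasure (⊤ : TopologicalSpace.PositiveCompacts K))
  ext k
  simp only [Set.mem_preimage, Set.mem_singleton_iff, Set.mem_empty_iff_false, iff_false]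
  rintro rfl
  exact hxK k.2

/-- A distribution whose characteristic function vanishes outside the annihilator of a compact
subgroup `K` has the Haar distribution of `K` as a factor. -/
theorem isFactor_haarDistribution (K : AddSubgroup X) [CompactSpace K] (μ : Measure X)
    [IsProbabilityMeasure μ]
    (h : ∀ y : AddChar X Circle, charFunction μ y ≠ 0 → ∀ x ∈ K, y x = 1) :
    IsFactor (haarDistribution K) μ := by
  have := isProbabilityMeasure_haarDistribution K
  -- The cofactor is `μ` itself: the Haar transform is 1 wherever that of `μ` is nonzero.
  refine ⟨μ, inferInstance, eq_of_charFunction_eq fun y => ?_⟩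
  rw [charFunction_conv]
  by_cases hy : charFunction μ y = 0
  · simp [hy]
  · rw [charFunction_haarDistribution_eq_one K (h y hy), one_mul]

/-- If the characteristic function of `μ` vanishes outside the annihilator of `K`, then `K` is
finite. -/
theorem finite_of_charFunction_ne_zero (htors : IsAddTorsion X) (K : AddSubgroup X) (μ : Measure X)
    [IsProbabilityMeasure μ]
    (h : ∀ y : AddChar X Circle, charFunction μ y ≠ 0 → ∀ x ∈ K, y x = 1) : Finite K := by
  -- A finite set `T` carries mass at least 3/4. If `y` is trivial on the finite subgroup generated
  -- by `T`, then |1 - μ̂(y)| ≤ 2 · 1/4 < 1, so μ̂(y) ≠ 0 and `y` is trivial on `K`; by duality `K`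
  -- lies in that subgroup.
  obtain ⟨T, hT, hμT⟩ := isTightMeasureSet_iff_exists_isCompact_measure_compl_le.1
    (isTightMeasureSet_singleton (μ := μ)) (1 / 4) (by simp)
  have hμT := hμT μ rfl
  have hTfin : T.Finite := isCompact_iff_finite.1 hT
  let F : AddSubgroup X := AddSubgroup.closure T
  have : Finite F := by
    have : AddGroup.FG F := (AddGroup.fg_iff_addSubgroup_fg F).2 ⟨hTfin.toFinset, by simp [F]⟩
    exact AddCommGroup.finite_of_fg_isAddTorsion F (htors.addSubgroup F)
  refine Finite.of_injective _ (AddSubgroup.inclusion_injective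
    (le_of_forall_addChar (H := F) (K := K) fun y hy => h y fun h0 => ?_))
  have hint := integrable_addChar μ y
  have hTy : ∀ x ∈ T, (y x : ℂ) = 1 := fun x hx => by
    rw [hy x (AddSubgroup.subset_closure hx)]; simp
  have h1 : (1 : ℂ) = ∫ x, (1 - (y x : ℂ)) ∂μ := by
    rw [integral_sub (integrable_const _) hint]
    change _ = _ - charFunction μ y
    simp [h0]
  have h2 : ∫ x, (1 - (y x : ℂ)) ∂μ = ∫ x in Tᶜ, (1 - (y x : ℂ)) ∂μ := by
    refine (setIntegral_eq_integral_of_forall_compl_eq_zero fun x hx => ?_).symm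
    rw [hTy x (by simpa using hx), sub_self]
  have h3 : ‖∫ x in Tᶜ, (1 - (y x : ℂ)) ∂μ‖ ≤ 2 * μ.real Tᶜ :=
    norm_setIntegral_le_of_norm_le_const (measure_lt_top _ _) fun x _ => by
      refine (norm_sub_le _ _).trans ?_
      rw [Circle.norm_coe]; norm_num
  have h4 : μ.real Tᶜ ≤ 1 / 4 := by
    have := ENNReal.toReal_mono (by simp) hμT
    simpa [measureReal_def] using this
  rw [← h2, ← h1, norm_one] at h3
  linarith

omit [DiscreteTopology X] [BorelSpace X] in
theorem isLeast_support_top (μ : Measure X) [IsProbabilityMeasure μ]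
    (h : ∀ y : AddChar X Circle, charFunction μ y = 1 → y = 0) :
    IsLeast {K : AddSubgroup X | μ.support ⊆ (K : Set X)} ⊤ := by
  refine ⟨by simp, fun K hK => le_of_forall_addChar fun y hy x _ => ?_⟩
  rw [h y (charFunction_eq_one_of_forall μ fun x hx => hy x (hK ?_)), AddChar.zero_apply]
  rw [Measure.mem_support_iff_forall]
  exact fun U hU => (pos_iff_ne_zero.2 hx).trans_le
    (measure_mono (Set.singleton_subset_iff.2 (mem_of_mem_nhds hU)))

end Haar

/-! ### Heyde's functional equation -/

section Equation

variable {X : Type*} [AddCommGroup X] [MeasurableSpace X] [DiscreteMeasurableSpace X] [Countable X]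

theorem map_prodMk_neg_eq {Ω : Type*} [MeasurableSpace Ω] {P : Measure Ω} [IsProbabilityMeasure P]
    {L₁ L₂ : Ω → X} (h₁ : Measurable L₁) (h₂ : Measurable L₂) (h : CondSymmetric P L₂ L₁) :
    P.map (fun ω => (L₁ ω, L₂ ω)) = P.map (fun ω => (L₁ ω, -L₂ ω)) := by
  have hn : Measurable (fun ω => -L₂ ω) := (Measurable.of_discrete (f := Neg.neg)).comp h₂
  refine Measure.ext_of_singleton fun ⟨a, b⟩ => ?_
  rw [Measure.map_apply (h₁.prodMk h₂) (measurableSet_singleton _),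
    Measure.map_apply (h₁.prodMk hn) (measurableSet_singleton _)]
  have hm : MeasurableSpace.comap L₁ inferInstance ≤ (inferInstance : MeasurableSpace Ω) :=
    h₁.comap_le
  have hA : MeasurableSet[MeasurableSpace.comap L₁ inferInstance] (L₁ ⁻¹' {a}) :=
    ⟨{a}, measurableSet_singleton a, rfl⟩
  -- Integrating the conditional probability over the event L₁ = a recovers the atoms of the joint
  -- law.
  have key : ∀ L : Ω → X, Measurable L →
      ∫ ω in L₁ ⁻¹' {a}, (P⟦{ω | L ω ∈ ({b} : Set X)} |
        MeasurableSpace.comap L₁ inferInstance⟧) ω ∂P =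
      P.real ((fun ω => (L₁ ω, L ω)) ⁻¹' {(a, b)}) := by
    intro L hL
    have hB : MeasurableSet {ω | L ω ∈ ({b} : Set X)} := hL (measurableSet_singleton b)
    rw [setIntegral_condExp hm ((integrable_const (1 : ℝ)).indicator hB) hA,
      integral_indicator hB, Measure.restrict_restrict hB]
    simp only [integral_const, smul_eq_mul, mul_one, measureReal_restrict_apply_univ]
    congr 1
    ext ω
    simp [and_comm]
  have h' := h {b} (measurableSet_singleton b)
  have heq := (key L₂ h₂).symm.trans
    ((setIntegral_congr_ae (hm _ hA) (h'.mono fun ω hω _ => hω)).trans (key _ hn))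
  rwa [measureReal_def, measureReal_def,
    ENNReal.toReal_eq_toReal_iff' (measure_ne_top _ _) (measure_ne_top _ _)] at heq

/-- The Heyde functional equation. -/
theorem charFunction_mul_charFunction_eq {Ω : Type*} [MeasurableSpace Ω] {P : Measure Ω}
    [IsProbabilityMeasure P] {ξ₁ ξ₂ : Ω → X} (hξ₁ : Measurable ξ₁) (hξ₂ : Measurable ξ₂)
    (hindep : IndepFun ξ₁ ξ₂ P) (α : X ≃+ X)
    (hsymm : CondSymmetric P (fun ω => ξ₁ ω + α (ξ₂ ω)) (fun ω => ξ₁ ω + ξ₂ ω))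
    (u v : AddChar X Circle) :
    charFunction (P.map ξ₁) (u + v) *
        charFunction (P.map ξ₂) (u + v.compAddMonoidHom α.toAddMonoidHom) =
      charFunction (P.map ξ₁) (u - v) *
        charFunction (P.map ξ₂) (u - v.compAddMonoidHom α.toAddMonoidHom) := by
  have hα : Measurable α := Measurable.of_discrete
  have hL₁ : Measurable (fun ω => ξ₁ ω + ξ₂ ω) := hξ₁.add hξ₂
  have hL₂ : Measurable (fun ω => ξ₁ ω + α (ξ₂ ω)) := hξ₁.add (hα.comp hξ₂)
  have hn : Measurable (fun ω => -(ξ₁ ω + α (ξ₂ ω))) :=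
    (Measurable.of_discrete (f := Neg.neg)).comp hL₂
  have hmap := map_prodMk_neg_eq hL₁ hL₂ hsymm
  have hprod : ∀ w z : AddChar X Circle,
      charFunction (P.map ξ₁) w * charFunction (P.map ξ₂) z =
        ∫ ω, (w (ξ₁ ω) : ℂ) * (z (ξ₂ ω) : ℂ) ∂P := by
    intro w z
    rw [charFunction, charFunction,
      integral_map hξ₁.aemeasurable Measurable.of_discrete.aestronglyMeasurable,
      integral_map hξ₂.aemeasurable Measurable.of_discrete.aestronglyMeasurable]
    exact (hindep.integral_fun_comp_mul_comp hξ₁.aemeasurable hξ₂.aemeasurable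
      (f := fun x => (w x : ℂ)) (g := fun x => (z x : ℂ))
      Measurable.of_discrete.aestronglyMeasurable
      Measurable.of_discrete.aestronglyMeasurable).symm
  have hint := congrArg (fun ν : Measure (X × X) => ∫ p, (u p.1 : ℂ) * (v p.2 : ℂ) ∂ν) hmap
  beta_reduce at hint
  rw [integral_map (hL₁.prodMk hL₂).aemeasurable Measurable.of_discrete.aestronglyMeasurable,
    integral_map (hL₁.prodMk hn).aemeasurable Measurable.of_discrete.aestronglyMeasurable] at hint
  rw [hprod, hprod]
  convert hint using 3 with ω ω
  · simp only [AddChar.add_apply, AddChar.map_add_eq_mul, AddChar.compAddMonoidHom_apply,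
      Circle.coe_mul]
    simp
    ring
  · simp only [AddChar.sub_apply, AddChar.map_add_eq_mul, AddChar.compAddMonoidHom_apply,
      Circle.coe_mul, AddChar.map_neg_eq_inv, mul_inv]
    simp
    ring

end Equation

/-! ### Modulus relations along automorphisms -/

section Heyde

variable {X : Type*} [AddCommGroup X]
  (hcyc : ∀ p : ℕ, p.Prime → IsAddCyclic (AddCommGroup.primaryComponent X p))
  (htors : IsAddTorsion X)
include hcyc htors

/-- Since `σ z` and `z` have the same order, they generate the same cyclic subgroup. -/
theorem addChar_apply_eq_one_of_addEquiv (σ : X ≃+ X) (y : AddChar X Circle) {z : X}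
    (h : y (σ z) = 1) : y z = 1 := by
  obtain ⟨k, hk⟩ := AddSubgroup.mem_zmultiples_iff.1
    (mem_zmultiples_of_addOrderOf_eq hcyc htors (AddEquiv.addOrderOf_eq σ z).symm)
  rw [← hk, AddChar.map_zsmul_eq_zpow, h, one_zpow]

variable [MeasurableSpace X] [DiscreteMeasurableSpace X] [Countable X]

/-- The moduli increase along the iterates of `γ`. Orbits being finite, the k!-th iterate eventually
fixes each point, so by dominated convergence the transforms return to the initial value. -/
theorem norm_charFunction_comp_eq (μ : Measure X) [IsProbabilityMeasure μ] (γ : X ≃+ X)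
    (h : ∀ y, ‖charFunction μ y‖ ≤ ‖charFunction μ (y.compAddMonoidHom γ.toAddMonoidHom)‖)
    (y : AddChar X Circle) :
    ‖charFunction μ (y.compAddMonoidHom γ.toAddMonoidHom)‖ = ‖charFunction μ y‖ := by
  let c : AddChar X Circle → AddChar X Circle := fun y => y.compAddMonoidHom γ.toAddMonoidHom
  have hc : ∀ k y x, (c^[k] y) x = y (γ^[k] x) := by
    intro k
    induction k with
    | zero => intro y x; rfl
    | succ k ih =>
      intro y x
      rw [Function.iterate_succ_apply, ih, Function.iterate_succ_apply']
      rfl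
  have hmono : ∀ k, ‖charFunction μ (c y)‖ ≤ ‖charFunction μ (c^[k + 1] y)‖ := by
    intro k
    induction k with
    | zero => exact le_rfl
    | succ k ih =>
      rw [Function.iterate_succ_apply' c (k + 1)]
      exact ih.trans (h _)
  have hlim : Filter.Tendsto (fun k : ℕ => charFunction μ (c^[k.factorial] y)) Filter.atTop
      (nhds (charFunction μ y)) := by
    refine tendsto_integral_of_dominated_convergence (fun _ => (1 : ℝ))
      (fun k => (integrable_addChar μ _).aestronglyMeasurable) (integrable_const _)
      (fun k => Filter.Eventually.of_forall fun _ => (Circle.norm_coe _).le)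
      (Filter.Eventually.of_forall fun x => ?_)
    obtain ⟨k, hk, hkx⟩ := exists_iterate_addEquiv_apply_eq hcyc htors γ x
    refine tendsto_const_nhds.congr' ?_
    filter_upwards [Filter.eventually_ge_atTop k] with m hm
    have hper : Function.IsPeriodicPt γ m.factorial x :=
      Function.IsPeriodicPt.trans_dvd (m := k) hkx (Nat.dvd_factorial hk hm)
    rw [hc, hper]
  refine le_antisymm (ge_of_tendsto hlim.norm (Filter.Eventually.of_forall fun k => ?_)) (h y)
  obtain ⟨j, hj⟩ := Nat.exists_eq_succ_of_ne_zero k.factorial_ne_zero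
  rw [hj]
  exact hmono j

omit [DiscreteMeasurableSpace X] in
theorem norm_charFunction_eq_one_of_comp (μ : Measure X) [IsProbabilityMeasure μ] (σ : X ≃+ X)
    (E : X →+ X) (y : AddChar X Circle)
    (h : ‖charFunction μ ((y.compAddMonoidHom σ.toAddMonoidHom).compAddMonoidHom E)‖ = 1) :
    ‖charFunction μ (y.compAddMonoidHom E)‖ = 1 := by
  rw [norm_charFunction_eq_one_iff] at h ⊢
  exact fun x x' hx hx' => addChar_apply_eq_one_of_addEquiv hcyc htors σ y (h x x' hx hx')

/-- Multiplicative relations between the moduli of two characteristic functions along automorphisms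
`D`, `T`, `α` and an endomorphism `E` confine both to the annihilator of the range of `E`. -/
theorem apply_eq_one_of_charFunction_ne_zero (μ₁ μ₂ : Measure X) [IsProbabilityMeasure μ₁]
    [IsProbabilityMeasure μ₂] (D T α : X ≃+ X) (E : X →+ X)
    (hchar : ∀ y, ‖charFunction μ₁ y‖ = 1 → ‖charFunction μ₂ y‖ = 1 → y = 0)
    (h₁ : ∀ v : AddChar X Circle, ‖charFunction μ₁ (v.compAddMonoidHom D.toAddMonoidHom)‖ =
      ‖charFunction μ₁ (v.compAddMonoidHom E)‖ *
        ‖charFunction μ₂ (v.compAddMonoidHom (α.trans T).toAddMonoidHom)‖)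
    (h₂ : ∀ v : AddChar X Circle, ‖charFunction μ₂ (v.compAddMonoidHom D.toAddMonoidHom)‖ =
      ‖charFunction μ₁ (v.compAddMonoidHom T.toAddMonoidHom)‖ *
        ‖charFunction μ₂ (v.compAddMonoidHom E)‖) (y : AddChar X Circle) :
    (charFunction μ₁ y ≠ 0 → ∀ x, y (E x) = 1) ∧ (charFunction μ₂ y ≠ 0 → ∀ x, y (E x) = 1) := by
  have hD : ∀ w : AddChar X Circle, (w.compAddMonoidHom D.symm.toAddMonoidHom).compAddMonoidHom
      D.toAddMonoidHom = w := fun w => by ext x; simp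
  have e₁ : ∀ w : AddChar X Circle, ‖charFunction μ₁ w‖ =
      ‖charFunction μ₁ ((w.compAddMonoidHom D.symm.toAddMonoidHom).compAddMonoidHom E)‖ *
        ‖charFunction μ₂ (w.compAddMonoidHom ((α.trans T).trans D.symm).toAddMonoidHom)‖ := by
    intro w
    have := h₁ (w.compAddMonoidHom D.symm.toAddMonoidHom)
    rwa [hD] at this
  have e₂ : ∀ w : AddChar X Circle, ‖charFunction μ₂ w‖ =
      ‖charFunction μ₁ (w.compAddMonoidHom (T.trans D.symm).toAddMonoidHom)‖ *
        ‖charFunction μ₂ ((w.compAddMonoidHom D.symm.toAddMonoidHom).compAddMonoidHom E)‖ := by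
    intro w
    have := h₂ (w.compAddMonoidHom D.symm.toAddMonoidHom)
    rwa [hD] at this
  let σ : X ≃+ X := T.trans D.symm
  let γ : X ≃+ X := ((α.trans T).trans D.symm).trans σ
  -- This is `e₁` inserted into `e₂`, leaving a relation for `μ₂` with two extra factors at most 1.
  have e₃ : ∀ w : AddChar X Circle, ‖charFunction μ₂ w‖ =
      ‖charFunction μ₁ ((w.compAddMonoidHom (D.symm.trans σ).toAddMonoidHom).compAddMonoidHom E)‖ *
      ‖charFunction μ₂ (w.compAddMonoidHom γ.toAddMonoidHom)‖ *
        ‖charFunction μ₂ ((w.compAddMonoidHom D.symm.toAddMonoidHom).compAddMonoidHom E)‖ := by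
    intro w
    rw [e₂ w, e₁ (w.compAddMonoidHom (T.trans D.symm).toAddMonoidHom)]
    rfl
  have hb₁ := norm_charFunction_le_one μ₁
  have hb₂ := norm_charFunction_le_one μ₂
  have hle : ∀ w : AddChar X Circle, ‖charFunction μ₂ w‖ ≤
      ‖charFunction μ₂ (w.compAddMonoidHom γ.toAddMonoidHom)‖ := by
    intro w
    rw [e₃ w]
    exact (mul_le_of_le_one_right (by positivity) (hb₂ _)).trans
      (mul_le_of_le_one_left (norm_nonneg _) (hb₁ _))
  have hγ := norm_charFunction_comp_eq hcyc htors μ₂ γ hle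
  have main : ∀ w : AddChar X Circle, charFunction μ₂ w ≠ 0 → ∀ x, w (E x) = 1 := by
    intro w hw x
    have hpos : 0 < ‖charFunction μ₂ w‖ := norm_pos_iff.2 hw
    have h3 := e₃ w
    rw [hγ] at h3
    set a := ‖charFunction μ₁
      ((w.compAddMonoidHom (D.symm.trans σ).toAddMonoidHom).compAddMonoidHom E)‖ with ha
    set b := ‖charFunction μ₂
      ((w.compAddMonoidHom D.symm.toAddMonoidHom).compAddMonoidHom E)‖ with hb
    have ha1 : a ≤ 1 := hb₁ _
    have hb1 : b ≤ 1 := hb₂ _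
    have ha0 : 0 ≤ a := norm_nonneg _
    have hb0 : 0 ≤ b := norm_nonneg _
    have hab : a * b = 1 := by
      refine mul_left_cancel₀ hpos.ne' ?_
      rw [mul_one]
      calc _ = a * ‖charFunction μ₂ w‖ * b := by ring
        _ = _ := h3.symm
    have hA : a = 1 := le_antisymm ha1 (hab ▸ mul_le_of_le_one_right ha0 hb1)
    have hB : b = 1 := le_antisymm hb1 (hab ▸ mul_le_of_le_one_left hb0 ha1)
    have h0 := hchar (w.compAddMonoidHom E)
      (norm_charFunction_eq_one_of_comp hcyc htors μ₁ _ E w hA)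
      (norm_charFunction_eq_one_of_comp hcyc htors μ₂ _ E w hB)
    exact DFunLike.congr_fun h0 x
  refine ⟨fun hy x => ?_, main y⟩
  -- By `e₁`, nonvanishing for `μ₁` at `y` passes to `μ₂` at a twist of `y` by an automorphism,
  -- which does not affect triviality.
  refine addChar_apply_eq_one_of_addEquiv hcyc htors ((α.trans T).trans D.symm) y
    (main (y.compAddMonoidHom ((α.trans T).trans D.symm).toAddMonoidHom) (fun h0 => hy ?_) x)
  have := e₁ y
  rw [h0, norm_zero, mul_zero] at this
  exact norm_eq_zero.1 this

end Heyde

end Heyde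

/-! ### Assembling the theorem -/

theorem corollary2p8 {X : Type*} [AddCommGroup X] [TopologicalSpace X] [DiscreteTopology X]
    [MeasurableSpace X] [BorelSpace X]
    (hX_torsion : IsAddTorsion X)
    (hX_cyclic : ∀ p : ℕ, p.Prime → IsAddCyclic (AddCommGroup.primaryComponent X p))
    (hX_two : ∀ x : X, addOrderOf x ≠ 2)
    (α : X ≃+ X)
    {Ω : Type*} [MeasurableSpace Ω] (P : Measure Ω) [IsProbabilityMeasure P]
    (ξ₁ ξ₂ : Ω → X) (hξ₁ : Measurable ξ₁) (hξ₂ : Measurable ξ₂) (hindep : IndepFun ξ₁ ξ₂ P)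
    (μ₁ μ₂ : Measure X) (hμ₁ : P.map ξ₁ = μ₁) (hμ₂ : P.map ξ₂ = μ₂)
    (hsymm : Heyde.CondSymmetric P (fun ω => ξ₁ ω + α (ξ₂ ω)) (fun ω => ξ₁ ω + ξ₂ ω))
    (hchar : {y : AddChar X Circle |
      ‖Heyde.charFunction μ₁ y‖ = 1 ∧ ‖Heyde.charFunction μ₂ y‖ = 1} = {0}) :
    ∃ μ : Measure X, μ₁ = μ ∧ μ₂ = μ ∧
      IsLeast {K : AddSubgroup X | μ.support ⊆ (K : Set X)} ⊤ ∧
      (∃ _ : Finite (Heyde.rangeIdAdd α),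
        Heyde.IsFactor (Heyde.haarDistribution (Heyde.rangeIdAdd α)) μ) ∧
      ∃ β : X ≃+ X, ∀ x : X, β x = x - α x := by
  have hcount : Countable X :=
    Heyde.countable_of_isAddCyclic_primaryComponent hX_cyclic hX_torsion
  have hp₁ : IsProbabilityMeasure μ₁ :=
    hμ₁ ▸ Measure.isProbabilityMeasure_map hξ₁.aemeasurable
  have hp₂ : IsProbabilityMeasure μ₂ :=
    hμ₂ ▸ Measure.isProbabilityMeasure_map hξ₂.aemeasurable
  have hchar' : ∀ y, ‖Heyde.charFunction μ₁ y‖ = 1 → ‖Heyde.charFunction μ₂ y‖ = 1 → y = 0 :=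
    fun y h₁ h₂ => (Set.ext_iff.1 hchar y).1 ⟨h₁, h₂⟩
  have heq := Heyde.charFunction_mul_charFunction_eq hξ₁ hξ₂ hindep α hsymm
  rw [hμ₁, hμ₂] at heq
  let T : X ≃+ X := AddEquiv.ofBijective (AddMonoidHom.id X + AddMonoidHom.id X)
    (Heyde.bijective_two_nsmul hX_torsion hX_two)
  let E : X →+ X := AddMonoidHom.id X + α.toAddMonoidHom
  let D' : X →+ X := AddMonoidHom.id X - α.toAddMonoidHom
  have hT : ∀ v : AddChar X Circle, v.compAddMonoidHom T.toAddMonoidHom = v + v := fun v => by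
    ext x; exact congrArg Subtype.val (v.map_add_eq_mul x x)
  have hE : ∀ v : AddChar X Circle,
      v.compAddMonoidHom E = v + v.compAddMonoidHom α.toAddMonoidHom := fun v => by
    ext x; exact congrArg Subtype.val (v.map_add_eq_mul x (α x))
  have hD' : ∀ v : AddChar X Circle,
      v.compAddMonoidHom D' = v - v.compAddMonoidHom α.toAddMonoidHom := fun v => by
    ext x
    refine congrArg Subtype.val ((v.map_sub_eq_div x (α x)).trans ?_)
    rw [AddChar.sub_apply, AddChar.map_neg_eq_inv, div_eq_mul_inv]
    rfl
  have k₂ : ∀ v : AddChar X Circle,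
      Heyde.charFunction μ₂ (v.compAddMonoidHom D') =
        Heyde.charFunction μ₁ (v.compAddMonoidHom T.toAddMonoidHom) *
        Heyde.charFunction μ₂ (v.compAddMonoidHom E) := by
    intro v
    rw [hD', hT, hE, heq v v, sub_self, Heyde.charFunction_zero, one_mul]
  have hsurj : Function.Surjective D' := by
    rw [← AddMonoidHom.range_eq_top, ← top_le_iff]
    refine Heyde.le_of_forall_addChar fun v hv x _ => ?_
    have hv0 : v.compAddMonoidHom D' = 0 := by
      ext z; exact congrArg Subtype.val (hv (D' z) ⟨z, rfl⟩)
    have hvα : v.compAddMonoidHom α.toAddMonoidHom = v := by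
      rw [hD', sub_eq_zero] at hv0; exact hv0.symm
    have h := k₂ v
    rw [hv0, hE, hvα, ← hT, Heyde.charFunction_zero] at h
    have hn := congrArg norm h
    rw [norm_one, norm_mul] at hn
    have a1 := Heyde.norm_charFunction_le_one μ₁ (v.compAddMonoidHom T.toAddMonoidHom)
    have a2 := Heyde.norm_charFunction_le_one μ₂ (v.compAddMonoidHom T.toAddMonoidHom)
    have h0 := hchar' _
      (le_antisymm a1 (hn.trans_le (mul_le_of_le_one_right (norm_nonneg _) a2)))
      (le_antisymm a2 (hn.trans_le (mul_le_of_le_one_left (norm_nonneg _) a1)))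
    obtain ⟨z, rfl⟩ := T.surjective x
    exact DFunLike.congr_fun h0 z
  let D : X ≃+ X := AddEquiv.ofBijective D'
    (Heyde.bijective_of_surjective hX_cyclic hX_torsion D' hsurj)
  have h₂ : ∀ v : AddChar X Circle,
      ‖Heyde.charFunction μ₂ (v.compAddMonoidHom D.toAddMonoidHom)‖ =
      ‖Heyde.charFunction μ₁ (v.compAddMonoidHom T.toAddMonoidHom)‖ *
        ‖Heyde.charFunction μ₂ (v.compAddMonoidHom E)‖ := fun v => by
    rw [← norm_mul, ← k₂ v]; rfl
  have h₁ : ∀ v : AddChar X Circle,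
      ‖Heyde.charFunction μ₁ (v.compAddMonoidHom D.toAddMonoidHom)‖ =
      ‖Heyde.charFunction μ₁ (v.compAddMonoidHom E)‖ *
        ‖Heyde.charFunction μ₂ (v.compAddMonoidHom (α.trans T).toAddMonoidHom)‖ := fun v => by
    -- Here u - v is the negative of `v.compAddMonoidHom D'`; the resulting conjugation disappears
    -- in the modulus.
    have h := heq (v.compAddMonoidHom α.toAddMonoidHom) v
    rw [sub_self, Heyde.charFunction_zero, mul_one, add_comm _ v, ← hE,
      ← neg_sub v, ← hD', Heyde.charFunction_neg] at h
    have hn := congrArg norm h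
    rw [norm_mul, RCLike.norm_conj] at hn
    refine hn.symm.trans ?_
    congr 3
    ext x
    refine congrArg Subtype.val ?_
    change v (α x) * v (α x) = v (α x + α x)
    rw [AddChar.map_add_eq_mul]
  have hsupp := Heyde.apply_eq_one_of_charFunction_ne_zero hX_cyclic hX_torsion μ₁ μ₂ D T α E
    hchar' h₁ h₂
  have hcf : ∀ y, Heyde.charFunction μ₁ y = Heyde.charFunction μ₂ y := by
    intro y
    by_cases hy : ∀ x, y (E x) = 1
    -- With `v` half of `y`, (I+α)v = 0 means αv = -v, so (I-α)v = 2v = y and `k₂` compares the two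
    -- transforms at `y`.
    · let v := y.compAddMonoidHom T.symm.toAddMonoidHom
      have hvE : v.compAddMonoidHom E = 0 := by
        ext x
        refine congrArg Subtype.val
          (Heyde.addChar_apply_eq_one_of_addEquiv hX_cyclic hX_torsion T y ?_)
        simpa using hy x
      have hvT : v.compAddMonoidHom T.toAddMonoidHom = y := by ext x; simp [v]
      have hvD : v.compAddMonoidHom D' = y := by
        rw [hE] at hvE
        rw [hD', ← hvT, hT, eq_neg_of_add_eq_zero_right hvE, sub_neg_eq_add]
      have h := k₂ v
      rw [hvE, hvT, hvD, Heyde.charFunction_zero, mul_one] at h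
      exact h.symm
    · rw [not_imp_comm.1 (hsupp y).1 hy, not_imp_comm.1 (hsupp y).2 hy]
  obtain rfl : μ₁ = μ₂ := Heyde.eq_of_charFunction_eq hcf
  have hann : ∀ y : AddChar X Circle, Heyde.charFunction μ₁ y ≠ 0 →
      ∀ x ∈ Heyde.rangeIdAdd α, y x = 1 := by
    rintro y hy _ ⟨x, rfl⟩
    exact (hsupp y).1 hy x
  have hfin := Heyde.finite_of_charFunction_ne_zero hX_torsion (Heyde.rangeIdAdd α) μ₁ hann
  refine ⟨μ₁, rfl, rfl, Heyde.isLeast_support_top μ₁ fun y hy => ?_, ⟨hfin, ?_⟩, D, fun x => rfl⟩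
  · have : ‖Heyde.charFunction μ₁ y‖ = 1 := by rw [hy, norm_one]
    exact hchar' y this this
  · exact Heyde.isFactor_haarDistribution _ μ₁ hann
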